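/- Let $m,n$ be positive integers with $n\le m\le\binom{2n}{2}$. Let $\mathcal G(2n,m)$ be the set of simple graphs with $2n$ vertices and $m$ edges, let $\operatorname{perfmat} G$ be the number of perfect matchings of $G$, and let $\mu(2n,m)=\max_{G\in\mathcal G(2n,m)}\operatorname{perfmat} G$. Put $$\omega(2n,m)=\bigl(\lfloor \tfrac mn\rfloor!\bigr)^{\frac{n-\alpha}{\lfloor m/n\rfloor}}\bigl(\lceil \tfrac mn\rceil!\bigr)^{\frac{\alpha}{\lceil m/n\rceil}},\qquad \alpha=m-n\lfloor \tfrac mn\rfloor .$$ Call $G$ almost regular if $|\deg u-\deg v|\le 1$ for all vertices $u,v$. For $d=0$ the expression $(d!)^{1/(2d)}$ is read as $0$. (1) For every $G=(V,E)\in\mathcal G(2n,m)$, $$\prod_{v\in V}(\deg(v)!)^{\frac{1}{2\deg(v)}}\le\omega(2n,m),$$ with equality if and only if $G$ is almost regular. Moreover $\operatorname{perfmat} G\le\omega(2n,m)$. (2) $\mu(2n,m)\le\omega(2n,m)$. Equality holds if and only if $\mathcal G(2n,m)$ contains a graph that is a disjoint union $\ell_1K_{n_1,n_1}\cup\ell_2K_{n_1+1,n_1+1}$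 of $\ell_1\ge1$ copies of $K_{n_1,n_1}$ and $\ell_2\ge0$ copies of $K_{n_1+1,n_1+1}$ for some $n_1\ge1$; equivalently, if and only if $n=\ell_1n_1+\ell_2(n_1+1)$ and $m=\ell_1n_1^2+\ell_2(n_1+1)^2$ for some integers $\ell_1\ge1$, $\ell_2\ge0$, $n_1\ge1$. (3) For such $n,m$ and any such $\ell_1,\ell_2,n_1$, a graph $G\in\mathcal G(2n,m)$ satisfies $\operatorname{perfmat} G=\mu(2n,m)$ if and only if $G$ is isomorphic to $\ell_1K_{n_1,n_1}\cup\ell_2K_{n_1+1,n_1+1}$. -/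

import Mathlib

open scoped Nat

namespace PerfMatBound

/-- The graphs on the vertex set `V` with exactly `m` edges. -/
def graphs (V : Type*) (m : ℕ) : Set (SimpleGraph V) :=
  {G | G.edgeSet.ncard = m}

/-- The number of perfect matchings of `G`. -/
noncomputable def perfmat {V : Type*} (G : SimpleGraph V) : ℕ :=
  Nat.card {M : G.Subgraph // M.IsPerfectMatching}

/-- The quantity `(d!) ^ (1 / (2 d))`, with the convention that it is `0` for `d = 0`
(that is, `0! = 0` in this expression, so isolated vertices make the degree product vanish). -/
noncomputable def degFactor (d : ℕ) : ℝ :=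
  if d = 0 then 0 else (d ! : ℝ) ^ (1 / (2 * (d : ℝ)))

/-- `∏_v (deg v)! ^ (1 / (2 deg v))`. -/
noncomputable def degProd {V : Type*} [Fintype V] (G : SimpleGraph V) [DecidableRel G.Adj] : ℝ :=
  ∏ v, degFactor (G.degree v)

/-- Any two degrees differ by at most one. -/
def AlmostRegular {V : Type*} [Fintype V] (G : SimpleGraph V) [DecidableRel G.Adj] : Prop :=
  ∀ u v, |(G.degree u : ℤ) - (G.degree v : ℤ)| ≤ 1

/-- `ω(2n, m) = (⌊m/n⌋!) ^ ((n - α) / ⌊m/n⌋) * (⌈m/n⌉!) ^ (α / ⌈m/n⌉)` with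
`α = m - n ⌊m/n⌋`. The first argument is `n`, half the number of vertices. Here `m / n` is the
floor and `m ⌈/⌉ n` the ceiling of the quotient; both are positive when `0 < n ≤ m`. -/
noncomputable def omega (n m : ℕ) : ℝ :=
  let α : ℝ := (m : ℝ) - (n : ℝ) * ((m / n : ℕ) : ℝ)
  ((m / n)! : ℝ) ^ (((n : ℝ) - α) / ((m / n : ℕ) : ℝ)) *
    ((m ⌈/⌉ n)! : ℝ) ^ (α / ((m ⌈/⌉ n : ℕ) : ℝ))

/-- `μ(2n, m)`, the maximal number of perfect matchings of a graph with `2n` vertices and `m`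
edges. The first argument is `n`, half the number of vertices. -/
noncomputable def mu (n m : ℕ) : ℕ :=
  sSup (perfmat '' graphs (Fin (2 * n)) m)

/-- The disjoint union of `l` copies of `H`. -/
def copies {W : Type*} (l : ℕ) (H : SimpleGraph W) : SimpleGraph (Fin l × W) where
  Adj x y := x.1 = y.1 ∧ H.Adj x.2 y.2
  symm := ⟨fun _ _ h => ⟨h.1.symm, h.2.symm⟩⟩
  loopless := ⟨fun _ h => h.2.ne rfl⟩

/-- The complete bipartite graph `K_{k,k}`. -/
abbrev balancedK (k : ℕ) : SimpleGraph (Fin k ⊕ Fin k) :=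
  completeBipartiteGraph (Fin k) (Fin k)

/-- The disjoint union `l₁ K_{k,k} ∪ l₂ K_{k+1,k+1}`. -/
abbrev unionK (l₁ l₂ k : ℕ) :
    SimpleGraph ((Fin l₁ × (Fin k ⊕ Fin k)) ⊕ (Fin l₂ × (Fin (k + 1) ⊕ Fin (k + 1)))) :=
  SimpleGraph.sum (copies l₁ (balancedK k)) (copies l₂ (balancedK (k + 1)))

end PerfMatBound

/-! Write L(d) = log(d!)/d. Two estimates combine. The Kahn–Lovász bound `log_card_le_logBound` says
log perfmat G ≤ ½ Σ L(deg v) when G has a perfect matching. Strict concavity of L on the positive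
integers makes ½ Σ L(deg v), for positive degrees with sum 2m on 2n vertices, at most log ω, with
equality exactly when all degrees are ⌊m/n⌋ or ⌊m/n⌋ + 1 (`sum_logFac_le_log_omega`).

Kahn–Lovász goes by induction on the vertex set S. In a uniformly random perfect matching σ the
partner of v has entropy at most log deg v, which compares the matchings of S with those of S − v −
σ v. Average over all v, insert the induction hypothesis and exchange sums: each pair (u, σ)
contributes at most |S|/2 · L(deg u), by concavity and log d = d L(d) − (d − 1) L(d − 1).

Equality forces every edge into a perfect matching, excludes triangles, and persists when the ends
of an edge are removed. Hence a minimal violation of "vertices with a common neighbour have equal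
neighbourhoods" has four or six vertices, and both cases are impossible
(`adj_of_log_card_eq_logBound`). So the components are complete bipartite, balanced by the perfect
matching, and of two consecutive sizes. Conversely, such a union has at least ω matchings, and n and
m determine its parameters. -/

namespace PerfMatBound

/-! ### Strict concavity of log(d!)/d -/

/-- The logarithm of `(d!) ^ (1 / d)`. -/
noncomputable def logFac (d : ℕ) : ℝ := Real.log (d ! : ℝ) / d

lemma log_factorial_succ (d : ℕ) :
    Real.log ((d + 1)! : ℝ) = Real.log ((d : ℝ) + 1) + Real.log (d ! : ℝ) := by
  rw [Nat.factorial_succ]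
  push_cast
  rw [Real.log_mul (by positivity) (by positivity)]

lemma mul_logFac (d : ℕ) : (d : ℝ) * logFac d = Real.log (d ! : ℝ) := by
  rcases Nat.eq_zero_or_pos d with rfl | h
  · simp
  · have : (d : ℝ) ≠ 0 := by positivity
    rw [logFac]; field_simp

/-- This is the negativity of the second difference of `logFac` over d + 1, d + 2, d + 3, cleared of
denominators. From d to d + 1 the gap grows by (d + 2)(d + 3)(2 log(d + 3) − log(d + 2) − log(d +
4)), positive by concavity of log. -/
lemma two_mul_log_factorial_lt (d : ℕ) :
    2 * Real.log ((d + 1)! : ℝ) <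
      ((d : ℝ) + 1) * (d + 4) * Real.log (d + 2) - (d + 1) * (d + 2) * Real.log (d + 3) := by
  have step : ∀ x : ℝ, 0 ≤ x → Real.log (x + 1) + Real.log (x + 3) < 2 * Real.log (x + 2) := by
    intro x hx
    rw [← Real.log_mul (by positivity) (by positivity), ← Real.log_rpow (by positivity)]
    apply Real.log_lt_log (by positivity)
    norm_num
    nlinarith
  induction d with
  | zero =>
    have h := step 0 le_rfl
    norm_num at h ⊢
    linarith
  | succ d ih =>
    rw [log_factorial_succ (d + 1)]
    have h := step (d + 1) (by positivity)
    have h2 : (0 : ℝ) < (d + 2) * (d + 3) := by positivity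
    have h3 := mul_lt_mul_of_pos_left h h2
    push_cast
    ring_nf at h3 ih ⊢
    linarith

lemma logFac_strictConcave {d : ℕ} (hd : 1 ≤ d) :
    logFac (d + 2) - logFac (d + 1) < logFac (d + 1) - logFac d := by
  obtain ⟨e, rfl⟩ := Nat.exists_eq_add_of_le' hd
  have h := two_mul_log_factorial_lt e
  have e1 := log_factorial_succ (e + 1)
  have e2 := log_factorial_succ (e + 1 + 1)
  rw [logFac, logFac, logFac, e2, e1]
  push_cast at h ⊢
  set F := Real.log ((e + 1)! : ℝ)
  have p1 : (0 : ℝ) < e + 1 := by positivity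
  have p2 : (0 : ℝ) < e + 1 + 1 := by positivity
  have p3 : (0 : ℝ) < e + 1 + 2 := by positivity
  rw [← sub_pos]
  have a1 : (e : ℝ) + 1 + 1 = e + 2 := by ring
  have a2 : (e : ℝ) + 2 + 1 = e + 3 := by ring
  have a3 : (e : ℝ) + 1 + 2 = e + 3 := by ring
  simp only [a1, a2, a3] at *
  have key : (Real.log (e + 2) + F) / (e + 2) - F / (e + 1) -
      ((Real.log (e + 3) + (Real.log (e + 2) + F)) / (e + 3) - (Real.log (e + 2) + F) / (e + 2)) =
      (((e : ℝ) + 1) * (e + 4) * Real.log (e + 2) - (e + 1) * (e + 2) * Real.log (e + 3) - 2 * F) /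
        ((e + 1) * (e + 2) * (e + 3)) := by
    field_simp
    ring
  rw [key]
  apply div_pos (by linarith) (by positivity)

lemma logFac_diff_strictAnti {a b : ℕ} (ha : 1 ≤ a) (hab : a < b) :
    logFac (b + 1) - logFac b < logFac (a + 1) - logFac a := by
  induction b, hab using Nat.le_induction with
  | base => exact logFac_strictConcave ha
  | succ b hb ih => exact (logFac_strictConcave (by omega)).trans ih

/-- The chord of `logFac` through `q` and `q + 1` lies above `logFac`, strictly so at all
positive integers other than `q` and `q + 1`. -/
lemma logFac_le_chord {q d : ℕ} (hq : 1 ≤ q) (hd : 1 ≤ d) :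
    logFac d ≤ logFac q + ((d : ℝ) - q) * (logFac (q + 1) - logFac q) ∧
    (d ≠ q → d ≠ q + 1 →
      logFac d < logFac q + ((d : ℝ) - q) * (logFac (q + 1) - logFac q)) := by
  have up : ∀ t : ℕ, logFac (q + 2 + t) <
      logFac q + (((q + 2 + t : ℕ) : ℝ) - q) * (logFac (q + 1) - logFac q) := by
    intro t
    induction t with
    | zero =>
      have := logFac_strictConcave hq
      push_cast
      simp only [add_zero]
      linarith
    | succ t ih =>
      have := logFac_diff_strictAnti hq (show q < q + 2 + t by omega)
      rw [← add_assoc]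
      push_cast at ih ⊢
      linarith
  have down : ∀ t : ℕ, t + 1 < q → logFac (q - (t + 1)) <
      logFac q + (((q - (t + 1) : ℕ) : ℝ) - q) * (logFac (q + 1) - logFac q) := by
    intro t ht
    induction t with
    | zero =>
      have := logFac_diff_strictAnti (show 1 ≤ q - 1 by omega) (show q - 1 < q by omega)
      rw [Nat.sub_add_cancel hq] at this
      push_cast [hq]
      linarith
    | succ t ih =>
      have := logFac_diff_strictAnti (show 1 ≤ q - (t + 1 + 1) by omega)
        (show q - (t + 1 + 1) < q by omega)
      rw [show q - (t + 1 + 1) + 1 = q - (t + 1) by omega] at this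
      have ih := ih (by omega)
      rw [Nat.cast_sub (by omega)] at ih ⊢
      push_cast at ih ⊢
      linarith
  have strict : d ≠ q → d ≠ q + 1 →
      logFac d < logFac q + ((d : ℝ) - q) * (logFac (q + 1) - logFac q) := by
    intro h1 h2
    rcases lt_or_gt_of_ne h1 with h | h
    · have := down (q - d - 1) (by omega)
      rwa [show q - (q - d - 1 + 1) = d by omega] at this
    · have := up (d - q - 2)
      rwa [show q + 2 + (d - q - 2) = d by omega] at this
  refine ⟨?_, strict⟩
  by_cases h1 : d = q
  · subst h1; simp
  by_cases h2 : d = q + 1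
  · subst h2; push_cast; linarith
  exact (strict h1 h2).le

/-- The chord through d − 1 and d. Here `t` will count the neighbours lost when a matched pair is
removed; strictness at t = 2 is what rules out triangles in the equality case. -/
lemma logFac_le_of_add_eq {d e t : ℕ} (he : 1 ≤ e) (h : e + t = d) :
    logFac e ≤ logFac d - t * (logFac d - logFac (d - 1)) ∧
    (2 ≤ t → logFac e < logFac d - t * (logFac d - logFac (d - 1))) := by
  rcases Nat.eq_zero_or_pos t with rfl | ht
  · subst h; simp
  · obtain ⟨q, rfl⟩ : ∃ q, d = q + 1 := ⟨d - 1, by omega⟩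
    have := logFac_le_chord (q := q) (by omega) he
    have hc : (e : ℝ) = q + 1 - t := by
      rw [eq_sub_iff_add_eq]; exact_mod_cast h
    rw [hc] at this
    rw [Nat.add_sub_cancel]
    refine ⟨by linarith [this.1], fun h2 => ?_⟩
    linarith [this.2 (by omega) (by omega)]

open Finset

/-! ### The Kahn–Lovász bound by entropy -/

section Matchings

variable {V : Type*} [Fintype V] [DecidableEq V] (G : SimpleGraph V) [DecidableRel G.Adj]

/-- The perfect matchings of the subgraph induced on `S`, as involutions of `V` that fix the
complement of `S` pointwise. -/
def matchingsOn (S : Finset V) : Finset (Equiv.Perm V) :=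
  {σ | (∀ v, σ (σ v) = v) ∧ (∀ v ∈ S, G.Adj v (σ v)) ∧ ∀ v ∉ S, σ v = v}

/-- The number of neighbours of `v` in `S`. -/
def degOn (S : Finset V) (v : V) : ℕ := #{w ∈ S | G.Adj v w}

variable {G} {S : Finset V} {σ : Equiv.Perm V} {u v w : V}

lemma mem_matchingsOn : σ ∈ matchingsOn G S ↔
    (∀ v, σ (σ v) = v) ∧ (∀ v ∈ S, G.Adj v (σ v)) ∧ ∀ v ∉ S, σ v = v := by
  simp [matchingsOn]

lemma apply_mem_of_mem_matchingsOn (hσ : σ ∈ matchingsOn G S) (hv : v ∈ S) : σ v ∈ S := by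
  rw [mem_matchingsOn] at hσ
  by_contra h
  have := hσ.2.1 v hv
  rw [← hσ.2.2 _ h, hσ.1] at this
  exact this.ne rfl

/-- Composing with the transposition of v and w deletes or restores the matched pair. -/
lemma card_filter_matchingsOn (hv : v ∈ S) (hw : w ∈ S) (h : G.Adj v w) :
    #{σ ∈ matchingsOn G S | σ v = w} = #(matchingsOn G (S \ {v, w})) := by
  have hne := h.ne
  refine card_bij' (fun σ _ => σ * Equiv.swap v w) (fun σ _ => σ * Equiv.swap v w) ?_ ?_ ?_ ?_
  · intro σ hσ
    rw [mem_filter, mem_matchingsOn] at hσ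
    obtain ⟨⟨h1, h2, h3⟩, h4⟩ := hσ
    have h5 : σ w = v := by rw [← h4, h1]
    have hx : ∀ x, x ≠ v → x ≠ w → (σ * Equiv.swap v w) x = σ x := fun x a b => by
      simp [Equiv.swap_apply_of_ne_of_ne a b]
    have hv' : (σ * Equiv.swap v w) v = v := by simp [h5]
    have hw' : (σ * Equiv.swap v w) w = w := by simp [h4]
    have hn : ∀ x, x ≠ v → x ≠ w → σ x ≠ v ∧ σ x ≠ w := fun x a b =>
      ⟨fun e => b (by rw [← h1 x, e, h4]), fun e => a (by rw [← h1 x, e, h5])⟩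
    rw [mem_matchingsOn]
    refine ⟨fun x => ?_, fun x hxS => ?_, fun x hxS => ?_⟩
    · by_cases a : x = v
      · subst a; rw [hv', hv']
      by_cases b : x = w
      · subst b; rw [hw', hw']
      rw [hx x a b, hx _ (hn x a b).1 (hn x a b).2, h1]
    · simp only [mem_sdiff, mem_insert, mem_singleton, not_or] at hxS
      rw [hx x hxS.2.1 hxS.2.2]
      exact h2 x hxS.1
    · by_cases a : x = v
      · subst a; exact hv'
      by_cases b : x = w
      · subst b; exact hw'
      rw [hx x a b]
      exact h3 x (fun hS => hxS (by simp [hS, a, b]))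
  · intro σ hσ
    rw [mem_matchingsOn] at hσ
    obtain ⟨h1, h2, h3⟩ := hσ
    have h4 : σ v = v := h3 v (by simp)
    have h5 : σ w = w := h3 w (by simp)
    have hx : ∀ x, x ≠ v → x ≠ w → (σ * Equiv.swap v w) x = σ x := fun x a b => by
      simp [Equiv.swap_apply_of_ne_of_ne a b]
    have hv' : (σ * Equiv.swap v w) v = w := by simp [h5]
    have hw' : (σ * Equiv.swap v w) w = v := by simp [h4]
    have hn : ∀ x, x ≠ v → x ≠ w → σ x ≠ v ∧ σ x ≠ w := fun x a b =>
      ⟨fun e => a (by rw [← h1 x, e, h4]), fun e => b (by rw [← h1 x, e, h5])⟩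
    rw [mem_filter, mem_matchingsOn]
    refine ⟨⟨fun x => ?_, fun x hxS => ?_, fun x hxS => ?_⟩, hv'⟩
    · by_cases a : x = v
      · subst a; rw [hv', hw']
      by_cases b : x = w
      · subst b; rw [hw', hv']
      rw [hx x a b, hx _ (hn x a b).1 (hn x a b).2, h1]
    · by_cases a : x = v
      · subst a; rw [hv']; exact h
      by_cases b : x = w
      · subst b; rw [hw']; exact h.symm
      rw [hx x a b]
      exact h2 x (by simp [hxS, a, b])
    · have a : x ≠ v := fun e => hxS (e ▸ hv)
      have b : x ≠ w := fun e => hxS (e ▸ hw)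
      rw [hx x a b]
      exact h3 x (by simp [hxS])
  · intro σ _; simp [mul_assoc]
  · intro σ _; simp [mul_assoc]

lemma card_matchingsOn_sdiff_pos (hσ : σ ∈ matchingsOn G S) (hv : v ∈ S) :
    0 < #(matchingsOn G (S \ {v, σ v})) := by
  rw [← card_filter_matchingsOn hv (apply_mem_of_mem_matchingsOn hσ hv)
    ((mem_matchingsOn.1 hσ).2.1 v hv), card_pos]
  exact ⟨σ, by simp [hσ]⟩

lemma degOn_pos (hσ : σ ∈ matchingsOn G S) (hv : v ∈ S) : 0 < degOn G S v :=
  card_pos.2 ⟨σ v, mem_filter.2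
    ⟨apply_mem_of_mem_matchingsOn hσ hv, (mem_matchingsOn.1 hσ).2.1 v hv⟩⟩

/-- The Gibbs inequality for the partner of `v` in a uniformly random perfect matching. -/
lemma sum_log_card_le (hne : (matchingsOn G S).Nonempty) (hv : v ∈ S) :
    ∑ _σ ∈ matchingsOn G S, Real.log #(matchingsOn G S) ≤
      ∑ σ ∈ matchingsOn G S,
        (Real.log (degOn G S v) + Real.log #(matchingsOn G (S \ {v, σ v}))) ∧
    (∑ _σ ∈ matchingsOn G S, Real.log #(matchingsOn G S) =
      ∑ σ ∈ matchingsOn G S,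
        (Real.log (degOn G S v) + Real.log #(matchingsOn G (S \ {v, σ v}))) →
      ∀ w ∈ S, G.Adj v w → ∃ σ ∈ matchingsOn G S, σ v = w) := by
  set M := matchingsOn G S with hM
  set N : ℝ := ((#M : ℕ) : ℝ) with hN
  have hNpos : 0 < N := by rw [hN]; exact_mod_cast card_pos.2 hne
  set d : ℝ := ((degOn G S v : ℕ) : ℝ) with hd
  have hdpos : 0 < d := by
    obtain ⟨σ, hσ⟩ := hne
    rw [hd]; exact_mod_cast degOn_pos hσ hv
  have himg : M.image (fun σ => σ v) ⊆ {w ∈ S | G.Adj v w} := by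
    intro w hw
    obtain ⟨σ, hσ, rfl⟩ := mem_image.1 hw
    exact mem_filter.2 ⟨apply_mem_of_mem_matchingsOn hσ hv, (mem_matchingsOn.1 hσ).2.1 v hv⟩
  -- A partner w is attained by exactly as many σ as there are matchings of S \ {v, w}, so the
  -- reciprocal weights count the attained partners.
  have hinv : ∑ σ ∈ M, ((#(matchingsOn G (S \ {v, σ v})) : ℝ))⁻¹ = #(M.image fun σ => σ v) := by
    rw [sum_comp (fun w => ((#(matchingsOn G (S \ {v, w})) : ℝ))⁻¹) (fun σ : Equiv.Perm V => σ v),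
      card_eq_sum_ones, Nat.cast_sum]
    refine sum_congr rfl fun w hw => ?_
    obtain ⟨σ, hσ, rfl⟩ := mem_image.1 hw
    have hw' := mem_filter.1 (himg hw)
    have := card_matchingsOn_sdiff_pos hσ hv
    rw [card_filter_matchingsOn hv hw'.1 hw'.2, nsmul_eq_mul, Nat.cast_one]
    exact mul_inv_cancel₀ (by positivity)
  have hle : ∑ _σ ∈ M, Real.log N - ∑ σ ∈ M,
      (Real.log d + Real.log #(matchingsOn G (S \ {v, σ v}))) ≤
      N / d * #(M.image fun σ => σ v) - N := by
    -- The argument of log is the ratio of the uniform weight 1/d to the probability of the partner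
    -- σ v; then log x ≤ x − 1.
    calc _ = ∑ σ ∈ M, Real.log (N / d * ((#(matchingsOn G (S \ {v, σ v})) : ℝ))⁻¹) := by
          rw [← sum_sub_distrib]
          refine sum_congr rfl fun σ hσ => ?_
          have := card_matchingsOn_sdiff_pos hσ hv
          rw [Real.log_mul (by positivity) (by positivity), Real.log_div (by positivity)
            (by positivity), Real.log_inv]
          ring
      _ ≤ ∑ σ ∈ M, (N / d * ((#(matchingsOn G (S \ {v, σ v})) : ℝ))⁻¹ - 1) := by
          refine sum_le_sum fun σ hσ => Real.log_le_sub_one_of_pos ?_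
          have := card_matchingsOn_sdiff_pos hσ hv
          positivity
      _ = _ := by rw [sum_sub_distrib, ← mul_sum, hinv]; simp [hN]
  have hcard : (#(M.image fun σ => σ v) : ℝ) ≤ d := by
    rw [hd]; exact_mod_cast card_le_card himg
  have hND : N / d * d = N := by field_simp
  have hNd : 0 < N / d := by positivity
  constructor
  · nlinarith
  · intro heq w hw hvw
    have h1 : d ≤ #(M.image fun σ => σ v) := by
      by_contra hlt
      nlinarith
    have h2 : #{w ∈ S | G.Adj v w} ≤ #(M.image fun σ => σ v) := by
      rw [hd] at h1; exact_mod_cast h1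
    have h3 : w ∈ M.image (fun σ => σ v) := by
      rw [eq_of_subset_of_card_le himg h2]; exact mem_filter.2 ⟨hw, hvw⟩
    simpa using h3

lemma degOn_sdiff_add (hσ : σ ∈ matchingsOn G S) (hv : v ∈ S) :
    degOn G (S \ {v, σ v}) u +
      ((if G.Adj u v then 1 else 0) + (if G.Adj u (σ v) then 1 else 0)) = degOn G S u := by
  have hne : v ≠ σ v := ((mem_matchingsOn.1 hσ).2.1 v hv).ne
  have hsub : ({v, σ v} : Finset V) ⊆ S := by
    intro x hx
    rw [mem_insert, mem_singleton] at hx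
    rcases hx with rfl | rfl
    · exact hv
    · exact apply_mem_of_mem_matchingsOn hσ hv
  simp only [degOn, card_filter]
  rw [← sum_sdiff hsub, sum_pair hne]

/-- The contribution of a vertex `u` and a matching `σ` to the induction step. -/
lemma log_degOn_add_sum_le (hσ : σ ∈ matchingsOn G S) (hu : u ∈ S) :
    Real.log (degOn G S u) +
        ∑ v ∈ S \ {u, σ u}, logFac (degOn G (S \ {v, σ v}) u) / 2 ≤
      (#S : ℝ) / 2 * logFac (degOn G S u) ∧
    (Real.log (degOn G S u) +
        ∑ v ∈ S \ {u, σ u}, logFac (degOn G (S \ {v, σ v}) u) / 2 =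
      (#S : ℝ) / 2 * logFac (degOn G S u) →
      ∀ v ∈ S, G.Adj u v → ¬ G.Adj u (σ v)) := by
  obtain ⟨h1, h2, h3⟩ := mem_matchingsOn.1 hσ
  have hσu := apply_mem_of_mem_matchingsOn hσ hu
  have hne : u ≠ σ u := (h2 u hu).ne
  have hsub : ({u, σ u} : Finset V) ⊆ S := by
    intro x hx
    rw [mem_insert, mem_singleton] at hx
    rcases hx with rfl | rfl
    · exact hu
    · exact hσu
  set d := degOn G S u with hd
  have hdpos : 1 ≤ d := degOn_pos hσ hu
  set t : V → ℕ := fun v => (if G.Adj u v then 1 else 0) + (if G.Adj u (σ v) then 1 else 0) with ht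
  have hadd : ∀ v ∈ S, degOn G (S \ {v, σ v}) u + t v = d := fun v hv => degOn_sdiff_add hσ hv
  have hmem : ∀ {v}, v ∈ S \ {u, σ u} ↔ v ∈ S ∧ v ≠ u ∧ v ≠ σ u := by simp
  have hpos : ∀ v ∈ S \ {u, σ u}, 1 ≤ degOn G (S \ {v, σ v}) u := by
    intro v hv
    rw [hmem] at hv
    refine card_pos.2 ⟨σ u, ?_⟩
    simp only [mem_filter, mem_sdiff, mem_insert, mem_singleton, not_or]
    exact ⟨⟨hσu, hv.2.2.symm, fun e => hv.2.1 (σ.injective e).symm⟩, h2 u hu⟩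
  have hs1 : ∑ v ∈ S \ {u, σ u}, (if G.Adj u v then 1 else 0) = d - 1 := by
    have := sum_sdiff (f := fun v => if G.Adj u v then 1 else 0) hsub
    rw [sum_pair hne, if_neg (G.irrefl), if_pos (h2 u hu)] at this
    rw [hd, degOn, card_filter]
    omega
  have hs2 : ∑ v ∈ S \ {u, σ u}, (if G.Adj u (σ v) then 1 else 0) = d - 1 := by
    rw [← hs1]
    have hmap : ∀ v ∈ S \ {u, σ u}, σ v ∈ S \ {u, σ u} := by
      intro v hv
      rw [hmem] at hv ⊢
      exact ⟨apply_mem_of_mem_matchingsOn hσ hv.1, fun e => hv.2.2 (by rw [← e, h1]),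
        fun e => hv.2.1 (σ.injective e)⟩
    exact sum_bij' (fun v _ => σ v) (fun v _ => σ v) hmap hmap (fun v _ => h1 v) (fun v _ => h1 v)
      (fun _ _ => rfl)
  -- Each of the d − 1 neighbours of u other than σ u is counted twice, once as v and once as σ v.
  have hst : ∑ v ∈ S \ {u, σ u}, (t v : ℝ) = 2 * (d - 1) := by
    rw [← Nat.cast_sum, ht, sum_add_distrib, hs1, hs2]
    push_cast [hdpos]
    ring
  have hcard : (#(S \ {u, σ u}) : ℝ) = #S - 2 := by
    rw [cast_card_sdiff hsub, card_pair hne]; norm_num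
  -- For d = 1 the weight d − 1 vanishes, so the value of `logFac` at 0 is irrelevant.
  have hfac : Real.log d = d * logFac d - (d - 1) * logFac (d - 1) := by
    obtain ⟨e, he⟩ := Nat.exists_eq_add_of_le' hdpos
    rw [mul_logFac, he, log_factorial_succ, Nat.add_sub_cancel]
    push_cast
    rw [add_sub_cancel_right, mul_logFac]
    ring
  have hsum : Real.log d + ∑ v ∈ S \ {u, σ u},
      (logFac d - t v * (logFac d - logFac (d - 1))) / 2 = (#S : ℝ) / 2 * logFac d := by
    rw [← sum_div, sum_sub_distrib, ← sum_mul, hst, sum_const, nsmul_eq_mul, hcard, hfac]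
    ring
  have hle : ∀ v ∈ S \ {u, σ u}, logFac (degOn G (S \ {v, σ v}) u) / 2 ≤
      (logFac d - t v * (logFac d - logFac (d - 1))) / 2 := fun v hv => by
    linarith [(logFac_le_of_add_eq (hpos v hv) (hadd v (hmem.1 hv).1)).1]
  refine ⟨by linarith [sum_le_sum hle], fun heq v hv huv huσ => ?_⟩
  have hv' : v ∈ S \ {u, σ u} := by
    rw [hmem]
    refine ⟨hv, huv.ne', ?_⟩
    rintro rfl
    rw [h1] at huσ
    exact huσ.ne rfl
  have h4 := (sum_eq_sum_iff_of_le hle).1 (by linarith) v hv'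
  have h5 := (logFac_le_of_add_eq (hpos v hv') (hadd v hv)).2 (by simp [ht, huv, huσ])
  linarith

/-- Half the sum of `logFac` over the degrees in the subgraph induced on `S`. -/
noncomputable def logBound (G : SimpleGraph V) [DecidableRel G.Adj] (S : Finset V) : ℝ :=
  ∑ v ∈ S, logFac (degOn G S v) / 2

/-- Averaging over v is what lets the losses of each u be summed over all matched pairs. Taking the
smaller bounds as a hypothesis lets the equality analysis reuse the step: equality in the average
forces equality in every inequality used. -/
lemma log_card_le_logBound_step (hne : (matchingsOn G S).Nonempty) (hS : S.Nonempty)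
    (ih : ∀ v ∈ S, ∀ σ ∈ matchingsOn G S,
      Real.log #(matchingsOn G (S \ {v, σ v})) ≤ logBound G (S \ {v, σ v})) :
    Real.log #(matchingsOn G S) ≤ logBound G S ∧
    (Real.log #(matchingsOn G S) = logBound G S →
      (∀ v ∈ S, ∀ w ∈ S, G.Adj v w → ∃ σ ∈ matchingsOn G S, σ v = w) ∧
      (∀ v ∈ S, ∀ σ ∈ matchingsOn G S,
        Real.log #(matchingsOn G (S \ {v, σ v})) = logBound G (S \ {v, σ v})) ∧
      (∀ u ∈ S, ∀ σ ∈ matchingsOn G S, ∀ v ∈ S, G.Adj u v → ¬ G.Adj u (σ v))) := by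
  set M := matchingsOn G S with hM
  have hA : ∀ v ∈ S, _ := fun v hv => (sum_log_card_le hne hv).1
  have hB : ∀ v ∈ S, ∀ σ ∈ M,
      Real.log (degOn G S v) + Real.log #(matchingsOn G (S \ {v, σ v})) ≤
      Real.log (degOn G S v) + logBound G (S \ {v, σ v}) :=
    fun v hv σ hσ => by linarith [ih v hv σ hσ]
  have hB' := fun v hv => sum_le_sum (hB v hv)
  have hC : ∀ σ ∈ M, ∀ u ∈ S, _ := fun σ hσ u hu => (log_degOn_add_sum_le hσ hu).1
  have hC' := fun σ hσ => sum_le_sum (hC σ hσ)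
  have hswap : ∑ v ∈ S, ∑ σ ∈ M, (Real.log (degOn G S v) + logBound G (S \ {v, σ v})) =
      ∑ σ ∈ M, ∑ u ∈ S, (Real.log (degOn G S u) +
        ∑ v ∈ S \ {u, σ u}, logFac (degOn G (S \ {v, σ v}) u) / 2) := by
    rw [sum_comm]
    refine sum_congr rfl fun σ hσ => ?_
    rw [sum_add_distrib, sum_add_distrib]
    congr 1
    -- As σ is an involution, u survives removing {v, σ v} exactly when v survives removing {u, σ
    -- u}.
    refine sum_comm' fun v u => ?_
    have h1 := (mem_matchingsOn.1 hσ).1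
    simp only [mem_sdiff, mem_insert, mem_singleton, not_or]
    have : u = σ v ↔ v = σ u := ⟨fun e => by rw [e, h1], fun e => by rw [e, h1]⟩
    rw [this]
    tauto
  have hl : ∑ _v ∈ S, ∑ _σ ∈ M, Real.log #M = #S * #M * Real.log #M := by
    simp [mul_assoc]
  have hr : ∑ _σ ∈ M, ∑ u ∈ S, (#S : ℝ) / 2 * logFac (degOn G S u) =
      #S * #M * logBound G S := by
    rw [sum_const, nsmul_eq_mul, logBound, ← mul_sum, ← sum_div]
    ring
  have hpos : (0 : ℝ) < #S * #M := by
    have := card_pos.2 hne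
    have := card_pos.2 hS
    positivity
  have sA := sum_le_sum hA
  have sB := sum_le_sum hB'
  have sC := sum_le_sum hC'
  refine ⟨?_, fun heq => ?_⟩
  · have : (#S * #M : ℝ) * Real.log #M ≤ #S * #M * logBound G S := by
      rw [← hl, ← hr]; linarith
    exact le_of_mul_le_mul_left this hpos
  · have hlr := hl.trans ((congrArg (fun x => (#S * #M : ℝ) * x) heq).trans hr.symm)
    have eA := (sum_eq_sum_iff_of_le hA).1 (by linarith)
    have eB := (sum_eq_sum_iff_of_le hB').1 (by linarith)
    have eC := (sum_eq_sum_iff_of_le hC').1 (by linarith)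
    refine ⟨fun v hv => (sum_log_card_le hne hv).2 (eA v hv), fun v hv σ hσ => ?_,
      fun u hu σ hσ => (log_degOn_add_sum_le hσ hu).2 ?_⟩
    · have := (sum_eq_sum_iff_of_le (hB v hv)).1 (eB v hv) σ hσ
      linarith
    · exact (sum_eq_sum_iff_of_le (hC σ hσ)).1 (eC σ hσ) u hu

/-- The Kahn–Lovász bound on the number of perfect matchings. -/
theorem log_card_le_logBound (hne : (matchingsOn G S).Nonempty) :
    Real.log #(matchingsOn G S) ≤ logBound G S := by
  induction S using Finset.strongInduction with
  | H S ih =>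
    rcases S.eq_empty_or_nonempty with rfl | hS
    · have : matchingsOn G ∅ ⊆ {1} := fun σ hσ => by
        rw [mem_singleton]; ext v; simpa using (mem_matchingsOn.1 hσ).2.2 v
      have h1 : #(matchingsOn G ∅) = 1 :=
        le_antisymm (by simpa using card_le_card this) (card_pos.2 hne)
      simp [h1, logBound]
    · refine (log_card_le_logBound_step hne hS fun v hv σ hσ => ih _ ?_ ?_).1
      · exact (ssubset_iff_of_subset sdiff_subset).2 ⟨v, hv, by simp⟩
      · exact card_pos.1 (card_matchingsOn_sdiff_pos hσ hv)

end Matchings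

/-! ### Equality in the Kahn–Lovász bound -/

section Equality

variable {V : Type*} [Fintype V] [DecidableEq V] {G : SimpleGraph V} [DecidableRel G.Adj]
  {S : Finset V}

/-- If the Kahn–Lovász bound is attained, vertices with a common neighbour have the same
neighbours. -/
theorem adj_of_log_card_eq_logBound (hne : (matchingsOn G S).Nonempty)
    (heq : Real.log #(matchingsOn G S) = logBound G S) :
    ∀ u ∈ S, ∀ v ∈ S, ∀ c ∈ S, ∀ d ∈ S, G.Adj u c → G.Adj v c → G.Adj u d → G.Adj v d := by
  induction S using Finset.strongInduction with
  | H S ih =>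
    intro u hu v hv c hc d hd huc hvc hud
    by_contra hvd
    obtain ⟨ext, eqs, tri⟩ := (log_card_le_logBound_step hne ⟨u, hu⟩ fun v hv σ hσ =>
      log_card_le_logBound (card_pos.1 (card_matchingsOn_sdiff_pos hσ hv))).2 heq
    have tri' : ∀ x ∈ S, ∀ y ∈ S, ∀ z ∈ S, G.Adj x y → G.Adj x z → ¬ G.Adj y z := by
      intro x hx y hy z hz hxy hxz hyz
      obtain ⟨σ, hσ, rfl⟩ := ext y hy z hz hyz
      exact tri x hx σ hσ y hy hxy hxz
    -- Equality persists after removing the ends of an edge, so by minimality every violating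
    -- quadruple meets every edge.
    have del : ∀ x ∈ S, ∀ y ∈ S, G.Adj x y → ∀ a ∈ S, ∀ b ∈ S, ∀ e ∈ S, ∀ f ∈ S,
        G.Adj a e → G.Adj b e → G.Adj a f → ¬ G.Adj b f →
        (a = x ∨ a = y) ∨ (b = x ∨ b = y) ∨ (e = x ∨ e = y) ∨ (f = x ∨ f = y) := by
      intro x hx y hy hxy a ha b hb e he f hf hae hbe haf hbf
      by_contra hcon
      simp only [not_or] at hcon
      obtain ⟨σ, hσ, rfl⟩ := ext x hx y hy hxy
      refine hbf (ih (S \ {x, σ x}) ((ssubset_iff_of_subset sdiff_subset).2 ⟨x, hx, by simp⟩)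
        (card_pos.1 (card_matchingsOn_sdiff_pos hσ hx)) (eqs x hx σ hσ) a ?_ b ?_ e ?_ f ?_
        hae hbe haf) <;>
      simp_all
    have key := fun x hx y hy hxy => del x hx y hy hxy u hu v hv c hc d hd huc hvc hud hvd
    obtain ⟨σ, hσ, hσu⟩ := ext u hu d hd hud
    obtain ⟨s1, s2, -⟩ := mem_matchingsOn.1 hσ
    have sS : ∀ x ∈ S, σ x ∈ S := fun x hx => apply_mem_of_mem_matchingsOn hσ hx
    have hσd : σ d = u := by rw [← hσu, s1]
    -- every vertex is one of `u`, `v`, `c`, `d` or the partner of `v` or `c`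
    have all : ∀ x ∈ S, x = u ∨ x = v ∨ x = c ∨ x = d ∨ x = σ v ∨ x = σ c := by
      intro x hx
      have := key x hx (σ x) (sS x hx) (s2 x hx)
      have inv : ∀ y, y = σ x → x = σ y := fun y h => by rw [h, s1]
      rcases this with (h | h) | (h | h) | (h | h) | (h | h)
      · simp [h]
      · simp [inv _ h, hσu]
      · simp [h]
      · simp [← inv _ h]
      · simp [h]
      · simp [← inv _ h]
      · simp [h]
      · simp [inv _ h, hσd]
    have huv : u ≠ v := fun h => hvd (h ▸ hud)
    have hcd : c ≠ d := fun h => hvd (h ▸ hvc)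
    have hdv : d ≠ v := fun h => tri' u hu c hc v hv huc (h ▸ hud) hvc.symm
    obtain ⟨τ, hτ, hτu⟩ := ext u hu c hc huc
    obtain ⟨t1, t2, -⟩ := mem_matchingsOn.1 hτ
    have tS : ∀ x ∈ S, τ x ∈ S := fun x hx => apply_mem_of_mem_matchingsOn hτ hx
    have hτc : τ c = u := by rw [← hτu, t1]
    have τne : ∀ x, x ≠ u → x ≠ c → τ x ≠ u ∧ τ x ≠ c := fun x h1 h2 =>
      ⟨fun e => h2 (by rw [← t1 x, e, hτu]), fun e => h1 (by rw [← t1 x, e, hτc])⟩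
    -- Here only u, v, c, d remain, and the matching τ through uc would have to join d to v.
    by_cases hvc' : σ v = c
    · have hσc : σ c = v := by rw [← hvc', s1]
      have hd' := all (τ d) (tS d hd)
      have h1 := τne d hud.ne' hcd.symm
      have h2 := t2 d hd
      rw [hvc', hσc] at hd'
      rcases hd' with h | h | h | h | h | h
      · exact h1.1 h
      · exact hvd (h ▸ h2).symm
      · exact h1.2 h
      · exact h2.ne h.symm
      · exact h1.2 h
      · exact hvd (h ▸ h2).symm
    · -- the remaining case has six vertices
      set e := σ v with he
      set f := σ c with hf
      have heS : e ∈ S := sS v hv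
      have hfS : f ∈ S := sS c hc
      have hve : G.Adj v e := s2 v hv
      have hcf : G.Adj c f := s2 c hc
      have hσe : σ e = v := s1 v
      have hσf : σ f = c := s1 c
      have hef' : e ≠ f := fun h => hvc.ne (σ.injective h)
      have heu : e ≠ u := fun h => hdv (by rw [← hσu, ← h, hσe])
      have hed : e ≠ d := fun h => huv (by rw [← hσd, ← h, hσe])
      have hfu : f ≠ u := fun h => hcd (by rw [← hσf, h, hσu])
      have hfd : f ≠ d := fun h => huc.ne (by rw [← hσd, ← h, hσf])
      have hfv : f ≠ v := fun h => hvc' (by rw [he, ← h, hσf])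
      have hef : ¬ G.Adj e f := by
        intro h
        rcases key e heS f hfS h with (h | h) | (h | h) | (h | h) | (h | h)
        · exact heu h.symm
        · exact hfu h.symm
        · exact hve.ne h
        · exact hfv h.symm
        · exact hvc' h.symm
        · exact hcf.ne h
        · exact hed h.symm
        · exact hfd h.symm
      have huf : ¬ G.Adj u f := tri' c hc u hu f hfS huc.symm hcf
      have hvf : ¬ G.Adj v f := tri' c hc v hv f hfS hvc.symm hcf
      -- The matching τ contains uc; v has no other available partner than e, which leaves f for d.
      have hτv : τ v = e := by
        have h1 := τne v huv.symm hvc.ne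
        have h2 := t2 v hv
        rcases all (τ v) (tS v hv) with h | h | h | h | h | h
        · exact absurd h h1.1
        · exact absurd h h2.ne'
        · exact absurd h h1.2
        · exact absurd (h ▸ h2) hvd
        · exact h
        · exact absurd (h ▸ h2) hvf
      have hdf : G.Adj d f := by
        have h1 := τne d hud.ne' hcd.symm
        have h2 := t2 d hd
        rcases all (τ d) (tS d hd) with h | h | h | h | h | h
        · exact absurd h h1.1
        · exact absurd (h ▸ h2).symm hvd
        · exact absurd h h1.2
        · exact absurd h h2.ne'
        · exact absurd (τ.injective (h.trans hτv.symm)) hdv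
        · rwa [h] at h2
      obtain ⟨ρ, hρ, hρv⟩ := ext v hv c hc hvc
      obtain ⟨r1, r2, -⟩ := mem_matchingsOn.1 hρ
      have rS : ∀ x ∈ S, ρ x ∈ S := fun x hx => apply_mem_of_mem_matchingsOn hρ hx
      have hρc : ρ c = v := by rw [← hρv, r1]
      have ρne : ∀ x, x ≠ v → x ≠ c → ρ x ≠ v ∧ ρ x ≠ c := fun x h1 h2 =>
        ⟨fun e => h2 (by rw [← r1 x, e, hρv]), fun e => h1 (by rw [← r1 x, e, hρc])⟩
      -- The matching ρ contains vc; if it joined u to d, it would have to join the non-adjacent e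
      -- and f.
      have hue : G.Adj u e := by
        have h1 := ρne u huv huc.ne
        have h2 := r2 u hu
        rcases all (ρ u) (rS u hu) with h | h | h | h | h | h
        · exact absurd h h2.ne'
        · exact absurd h h1.1
        · exact absurd h h1.2
        · exfalso
          have h3 := ρne e hve.ne' hvc'
          have h4 := r2 e heS
          have hρd : ρ d = u := by rw [← h, r1]
          rcases all (ρ e) (rS e heS) with g | g | g | g | g | g
          · exact hed (by rw [← r1 e, g, h])
          · exact h3.1 g
          · exact h3.2 g
          · exact heu (by rw [← r1 e, g, hρd])
          · exact h4.ne g.symm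
          · exact hef (g ▸ h4)
        · rwa [h] at h2
        · exact absurd (h ▸ h2) huf
      -- Now u and f share the neighbour d, while e is adjacent to u only: a violation disjoint from
      -- the edge vc.
      rcases del v hv c hc hvc u hu f hfS d hd e heS hud hdf.symm hue (fun h => hef h.symm) with
        (h | h) | (h | h) | (h | h) | (h | h)
      · exact huv h
      · exact huc.ne h
      · exact hfv h
      · exact hcf.ne' h
      · exact hdv h
      · exact hcd h.symm
      · exact hve.ne' h
      · exact hvc' h

end Equality

/-! ### Perfect matchings as fixed-point-free involutions -/

section PerfectMatchings

variable {V : Type*}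

/-- Perfect matchings correspond to involutions moving every vertex to a neighbour. -/
noncomputable def perfectMatchingEquiv (G : SimpleGraph V) :
    {M : G.Subgraph // M.IsPerfectMatching} ≃
      {σ : Equiv.Perm V // (∀ v, σ (σ v) = v) ∧ ∀ v, G.Adj v (σ v)} where
  toFun M :=
    have h := SimpleGraph.Subgraph.isPerfectMatching_iff.1 M.2
    have inv : Function.Involutive fun v => (h v).choose := fun v =>
      ((h _).choose_spec.2 v (h v).choose_spec.1.symm).symm
    ⟨inv.toPerm, inv, fun v => (h v).choose_spec.1.adj_sub⟩
  invFun σ :=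
    ⟨{ verts := Set.univ
       Adj := fun v w => σ.1 v = w
       adj_sub := by rintro v w rfl; exact σ.2.2 v
       edge_vert := fun _ => Set.mem_univ _
       symm := ⟨by rintro v w rfl; exact σ.2.1 v⟩ },
      SimpleGraph.Subgraph.isPerfectMatching_iff.2 fun v =>
        ⟨σ.1 v, rfl, fun _ h => Eq.symm h⟩⟩
  left_inv M := by
    have h := SimpleGraph.Subgraph.isPerfectMatching_iff.1 M.2
    apply Subtype.ext
    apply SimpleGraph.Subgraph.ext
    · exact (SimpleGraph.Subgraph.isSpanning_iff.1 M.2.2).symm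
    · ext v w
      change (h v).choose = w ↔ _
      exact ⟨fun e => e ▸ (h v).choose_spec.1, fun e => ((h v).choose_spec.2 w e).symm⟩
  right_inv σ := by
    apply Subtype.ext
    ext v
    exact (Exists.choose_spec (p := fun w => σ.1 v = w ∧ ∀ y, σ.1 v = y → y = w) _).1.symm

lemma perfmat_eq_card_matchingsOn [Fintype V] [DecidableEq V] (G : SimpleGraph V)
    [DecidableRel G.Adj] : perfmat G = #(matchingsOn G univ) := by
  rw [perfmat, Nat.card_congr (perfectMatchingEquiv G), Nat.subtype_card]
  intro σ
  simp [mem_matchingsOn]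

lemma perfmat_congr {W : Type*} {G : SimpleGraph V} {H : SimpleGraph W} (ψ : G ≃g H) :
    perfmat G = perfmat H := by
  rw [perfmat, perfmat, Nat.card_congr (perfectMatchingEquiv G),
    Nat.card_congr (perfectMatchingEquiv H)]
  refine Nat.card_congr (ψ.toEquiv.permCongr.subtypeEquiv fun σ => ?_)
  have h : ∀ v, ψ.toEquiv.permCongr σ (ψ v) = ψ (σ v) := fun v =>
    congrArg (fun x => ψ (σ x)) (ψ.symm_apply_apply v)
  refine and_congr ?_ ?_
  · refine Iff.trans (forall_congr' fun v => ?_) ψ.surjective.forall.symm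
    rw [h, h, ψ.injective.eq_iff]
  · refine Iff.trans (forall_congr' fun v => ?_) ψ.surjective.forall.symm
    rw [h, ψ.map_adj_iff]

lemma degOn_univ [Fintype V] [DecidableEq V] (G : SimpleGraph V) [DecidableRel G.Adj] (v : V) :
    degOn G univ v = G.degree v := by
  rw [degOn, ← SimpleGraph.card_neighborFinset_eq_degree, SimpleGraph.neighborFinset_eq_filter]

end PerfectMatchings

/-! ### Optimizing the degree sequence -/

section Degrees

variable {V : Type*} [Fintype V]

lemma omega_pos (n m : ℕ) : 0 < omega n m := by
  rw [omega]; positivity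

/-- The ceiling may be replaced by ⌊m/n⌋ + 1: they differ only when n divides m, and then the
exponent α is 0. -/
lemma log_omega {n m : ℕ} (hn : 0 < n) :
    Real.log (omega n m) = ((n : ℝ) - (m - n * (m / n : ℕ))) * logFac (m / n) +
      (m - n * (m / n : ℕ)) * logFac (m / n + 1) := by
  rw [omega, Real.log_mul (by positivity) (by positivity), Real.log_rpow (by positivity),
    Real.log_rpow (by positivity)]
  have key : (m : ℝ) - n * (m / n : ℕ) = 0 ∨ m ⌈/⌉ n = m / n + 1 := by
    rcases Nat.eq_zero_or_pos (m % n) with h | h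
    · left
      have := Nat.div_add_mod m n
      rw [h, add_zero] at this
      rw [sub_eq_zero]
      exact_mod_cast this.symm
    · right
      rw [Nat.ceilDiv_eq_add_pred_div]
      have := Nat.div_add_mod m n
      have h2 := Nat.mod_lt m hn
      rw [Nat.div_eq_iff hn]
      constructor
      · rw [add_mul, mul_comm]; omega
      · rw [add_mul, mul_comm]; omega
  rcases key with h | h
  · rw [h]; simp [logFac]; ring
  · rw [h, logFac, logFac]; ring

lemma sum_logFac_le_log_omega {n m : ℕ} (hn : 0 < n) (hnm : n ≤ m) {d : V → ℕ}
    (hd : ∀ v, 1 ≤ d v) (hV : Fintype.card V = 2 * n) (hsum : ∑ v, d v = 2 * m) :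
    ∑ v, logFac (d v) / 2 ≤ Real.log (omega n m) ∧
    (∑ v, logFac (d v) / 2 = Real.log (omega n m) ↔ ∀ v, d v = m / n ∨ d v = m / n + 1) := by
  have hq : 1 ≤ m / n := (Nat.one_le_div_iff hn).2 hnm
  have hle : ∀ v ∈ (univ : Finset V), logFac (d v) / 2 ≤
      (logFac (m / n) + ((d v : ℝ) - (m / n : ℕ)) * (logFac (m / n + 1) - logFac (m / n))) / 2 :=
    fun v _ => by linarith [(logFac_le_chord hq (hd v)).1]
  -- The chord at ⌊m/n⌋ is affine, so its sum depends only on the number of vertices and the degree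
  -- sum.
  have hs : ∑ v, (logFac (m / n) + ((d v : ℝ) - (m / n : ℕ)) *
      (logFac (m / n + 1) - logFac (m / n))) / 2 = Real.log (omega n m) := by
    have hsum' : ∑ v, (d v : ℝ) = 2 * m := by exact_mod_cast hsum
    rw [log_omega hn, ← sum_div, sum_add_distrib, ← sum_mul, sum_sub_distrib, hsum']
    simp only [sum_const, card_univ, hV, nsmul_eq_mul]
    push_cast
    ring
  rw [← hs]
  refine ⟨sum_le_sum hle, (sum_eq_sum_iff_of_le hle).trans ⟨fun h v => ?_, fun h v _ => ?_⟩⟩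
  · by_contra hcon
    rw [not_or] at hcon
    linarith [(logFac_le_chord hq (hd v)).2 hcon.1 hcon.2, h v (mem_univ v)]
  · rcases h v with h | h
    · rw [h]; ring
    · rw [h]; push_cast; ring

/-- The mean is m/n. One value below its floor would force all values to be at most the floor,
giving too small a sum; symmetrically above. -/
lemma forall_abs_sub_le_one_iff {n m : ℕ} (hn : 0 < n) {d : V → ℕ}
    (hV : Fintype.card V = 2 * n) (hsum : ∑ v, d v = 2 * m) :
    (∀ u v, |(d u : ℤ) - d v| ≤ 1) ↔ ∀ v, d v = m / n ∨ d v = m / n + 1 := by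
  have h1 : n * (m / n) ≤ m := Nat.mul_div_le m n
  have h2 : m < n * (m / n + 1) := Nat.lt_mul_div_succ m hn
  constructor
  · intro h v
    by_contra hcon
    rw [not_or] at hcon
    rcases Nat.lt_or_ge (d v) (m / n) with hlt | hge
    · have : ∑ u, d u < ∑ _u : V, m / n := by
        refine sum_lt_sum (fun u _ => ?_) ⟨v, mem_univ v, hlt⟩
        have := abs_le.1 (h u v); omega
      rw [sum_const, card_univ, hV, smul_eq_mul, hsum] at this
      nlinarith
    · have : ∑ _u : V, (m / n + 1) < ∑ u, d u := by
        refine sum_lt_sum (fun u _ => ?_) ⟨v, mem_univ v, by omega⟩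
        have := abs_le.1 (h u v); omega
      rw [sum_const, card_univ, hV, smul_eq_mul, hsum] at this
      nlinarith
  · intro h u v
    rw [abs_le]
    have hu := h u
    have hv := h v
    omega

lemma log_degFactor {d : ℕ} (hd : 1 ≤ d) : Real.log (degFactor d) = logFac d / 2 := by
  rw [degFactor, if_neg (by omega), Real.log_rpow (by positivity), logFac]
  have : (d : ℝ) ≠ 0 := by positivity
  field_simp

lemma degFactor_pos {d : ℕ} (hd : 1 ≤ d) : 0 < degFactor d := by
  rw [degFactor, if_neg (by omega)]; positivity

variable (G : SimpleGraph V) [DecidableRel G.Adj]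

lemma sum_degrees_of_mem_graphs {m : ℕ} (h : G ∈ graphs V m) : ∑ v, G.degree v = 2 * m := by
  classical
  rw [SimpleGraph.sum_degrees_eq_twice_card_edges, ← h, Set.ncard_eq_toFinset_card']
  rfl

theorem degProd_le_omega {n m : ℕ} (hn : 0 < n) (hnm : n ≤ m)
    (hV : Fintype.card V = 2 * n) (hG : G ∈ graphs V m) :
    degProd G ≤ omega n m ∧ (degProd G = omega n m ↔ AlmostRegular G) := by
  have hsum := sum_degrees_of_mem_graphs G hG
  have hreg : AlmostRegular G ↔ _ := forall_abs_sub_le_one_iff hn hV hsum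
  rw [hreg]
  by_cases hd : ∀ v, 1 ≤ G.degree v
  · have hpos : 0 < degProd G := prod_pos fun v _ => degFactor_pos (hd v)
    have hlog : Real.log (degProd G) = ∑ v, logFac (G.degree v) / 2 := by
      rw [degProd, Real.log_prod fun v _ => (degFactor_pos (hd v)).ne']
      exact sum_congr rfl fun v _ => log_degFactor (hd v)
    obtain ⟨h1, h2⟩ := sum_logFac_le_log_omega hn hnm hd hV hsum
    rw [← hlog] at h1 h2
    refine ⟨(Real.log_le_log_iff hpos (omega_pos n m)).1 h1, ?_⟩
    rw [← h2]
    exact ⟨fun h => by rw [h], fun h => Real.log_injOn_pos hpos (omega_pos n m) h⟩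
  -- With an isolated vertex the product is 0 < ω, and the graph is not almost regular since ⌊m/n⌋ ≥
  -- 1.
  · obtain ⟨v, hv⟩ := not_forall.1 hd
    have hv0 : G.degree v = 0 := by omega
    have h0 : degProd G = 0 := prod_eq_zero (mem_univ v) (by simp [degFactor, hv0])
    rw [h0]
    refine ⟨(omega_pos n m).le, fun h => absurd h (omega_pos n m).ne, fun h => ?_⟩
    have hq : 1 ≤ m / n := (Nat.one_le_div_iff hn).2 hnm
    have := h v
    omega

end Degrees

/-! ### Unions of complete bipartite graphs -/

section Labels

/-- Two graphs whose components are complete bipartite, as witnessed by a labelling of the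
vertices by components and sides, are isomorphic when the parts have the same sizes. -/
lemma nonempty_iso_of_labels {V W I J : Type*} {G : SimpleGraph V} {H : SimpleGraph W}
    {a : V → I} {s : V → Bool} {b : W → J} {t : W → Bool}
    (hG : ∀ v w, G.Adj v w ↔ a v = a w ∧ s v ≠ s w)
    (hH : ∀ v w, H.Adj v w ↔ b v = b w ∧ t v ≠ t w) (e : I ≃ J)
    (h : ∀ i x, Nonempty ({v // (a v, s v) = (i, x)} ≃ {w // (b w, t w) = (e i, x)})) :
    Nonempty (G ≃g H) := by
  let f := fun p : I × Bool => (h p.1 p.2).some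
  let g : (Σ p : I × Bool, {v // (a v, s v) = p}) ≃ (Σ p : J × Bool, {w // (b w, t w) = p}) :=
    Equiv.sigmaCongr (e.prodCongr (Equiv.refl Bool)) f
  let F : V ≃ W := (Equiv.sigmaFiberEquiv fun v => (a v, s v)).symm.trans
    (g.trans (Equiv.sigmaFiberEquiv fun w => (b w, t w)))
  have hF : ∀ v, (b (F v), t (F v)) = (e (a v), s v) := fun v => (f (a v, s v) ⟨v, rfl⟩).2
  refine ⟨⟨F, fun {v w} => ?_⟩⟩
  have hv := Prod.ext_iff.1 (hF v)
  have hw := Prod.ext_iff.1 (hF w)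
  simp only at hv hw
  rw [hG, hH, hv.1, hv.2, hw.1, hw.2, e.apply_eq_iff_eq]

variable {l₁ l₂ k : ℕ}

/-- The component of a vertex of `unionK l₁ l₂ k`. -/
def unionKComp : (Fin l₁ × (Fin k ⊕ Fin k)) ⊕ (Fin l₂ × (Fin (k + 1) ⊕ Fin (k + 1))) →
    Fin l₁ ⊕ Fin l₂ :=
  Sum.map Prod.fst Prod.fst

/-- The side of a vertex of `unionK l₁ l₂ k`. -/
def unionKSide : (Fin l₁ × (Fin k ⊕ Fin k)) ⊕ (Fin l₂ × (Fin (k + 1) ⊕ Fin (k + 1))) → Bool :=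
  Sum.elim (fun x => x.2.isLeft) (fun x => x.2.isLeft)

lemma unionK_adj_iff (v w) : (unionK l₁ l₂ k).Adj v w ↔
    unionKComp v = unionKComp w ∧ unionKSide v ≠ unionKSide w := by
  rcases v with ⟨i, a | a⟩ | ⟨i, a | a⟩ <;> rcases w with ⟨j, b | b⟩ | ⟨j, b | b⟩ <;>
    simp [unionK, copies, unionKComp, unionKSide]

lemma natCard_subtype_eq_of_range {W : Type*} {k : ℕ} {P : W → Prop} {f : Fin k → W}
    (hf : Function.Injective f) (h : ∀ w, (∃ a, f a = w) ↔ P w) : Nat.card {w // P w} = k :=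
  (Nat.card_congr ((Equiv.ofInjective f hf).trans (Equiv.subtypeEquivRight h))).symm.trans
    (Nat.card_fin k)

lemma card_unionK_part (i : Fin l₁ ⊕ Fin l₂) (x : Bool) :
    Nat.card {w : (Fin l₁ × (Fin k ⊕ Fin k)) ⊕ (Fin l₂ × (Fin (k + 1) ⊕ Fin (k + 1))) //
      (unionKComp w, unionKSide w) = (i, x)} = Sum.elim (fun _ => k) (fun _ => k + 1) i := by
  have inj : ∀ (α β : Type) (i : α), Function.Injective (fun a : β => (i, a)) :=
    fun _ _ i => Prod.mk_right_injective i
  rcases i with i | i <;> cases x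
  · refine natCard_subtype_eq_of_range (f := fun a => .inl (i, .inr a))
      (Sum.inl_injective.comp ((inj _ _ i).comp Sum.inr_injective)) ?_
    rintro (⟨j, b | b⟩ | ⟨j, b | b⟩) <;> simp [unionKComp, unionKSide, eq_comm]
  · refine natCard_subtype_eq_of_range (f := fun a => .inl (i, .inl a))
      (Sum.inl_injective.comp ((inj _ _ i).comp Sum.inl_injective)) ?_
    rintro (⟨j, b | b⟩ | ⟨j, b | b⟩) <;> simp [unionKComp, unionKSide, eq_comm]
  · refine natCard_subtype_eq_of_range (f := fun a => .inr (i, .inr a))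
      (Sum.inr_injective.comp ((inj _ _ i).comp Sum.inr_injective)) ?_
    rintro (⟨j, b | b⟩ | ⟨j, b | b⟩) <;> simp [unionKComp, unionKSide, eq_comm]
  · refine natCard_subtype_eq_of_range (f := fun a => .inr (i, .inl a))
      (Sum.inr_injective.comp ((inj _ _ i).comp Sum.inl_injective)) ?_
    rintro (⟨j, b | b⟩ | ⟨j, b | b⟩) <;> simp [unionKComp, unionKSide, eq_comm]

lemma degree_eq_card_part {V I : Type*} [Fintype V] {G : SimpleGraph V} [DecidableRel G.Adj]
    {a : V → I} {s : V → Bool} (hG : ∀ v w, G.Adj v w ↔ a v = a w ∧ s v ≠ s w) (v : V) :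
    G.degree v = Nat.card {w // (a w, s w) = (a v, !s v)} := by
  rw [← SimpleGraph.card_neighborSet_eq_degree, ← Nat.card_eq_fintype_card]
  refine Nat.card_congr (Equiv.subtypeEquivRight fun w => ?_)
  rw [SimpleGraph.mem_neighborSet, hG, Prod.mk.injEq, eq_comm (a := a v)]
  cases s v <;> cases s w <;> simp

lemma ncard_edgeSet_unionK : (unionK l₁ l₂ k).edgeSet.ncard = l₁ * k ^ 2 + l₂ * (k + 1) ^ 2 := by
  classical
  have h := sum_degrees_of_mem_graphs (unionK l₁ l₂ k) (m := (unionK l₁ l₂ k).edgeSet.ncard) rfl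
  simp only [degree_eq_card_part unionK_adj_iff, card_unionK_part] at h
  simp only [Fintype.sum_sum_type, unionKComp, Sum.map_inl, Sum.map_inr, Sum.elim_inl,
    Sum.elim_inr, sum_const, card_univ, Fintype.card_prod, Fintype.card_sum, Fintype.card_fin,
    smul_eq_mul] at h
  nlinarith

lemma card_unionK : Fintype.card ((Fin l₁ × (Fin k ⊕ Fin k)) ⊕
    (Fin l₂ × (Fin (k + 1) ⊕ Fin (k + 1)))) = 2 * (l₁ * k + l₂ * (k + 1)) := by
  simp only [Fintype.card_prod, Fintype.card_sum, Fintype.card_fin]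
  ring

/-- The involution of the vertices of `copies l (balancedK k)` given by a permutation for each
copy. -/
def copiesInvol {l k : ℕ} (π : Fin l → Equiv.Perm (Fin k)) :
    Fin l × (Fin k ⊕ Fin k) → Fin l × (Fin k ⊕ Fin k)
  | (i, .inl a) => (i, .inr (π i a))
  | (i, .inr a) => (i, .inl ((π i).symm a))

lemma copiesInvol_involutive {l k : ℕ} (π : Fin l → Equiv.Perm (Fin k)) :
    Function.Involutive (copiesInvol π) := by
  rintro ⟨i, a | a⟩ <;> simp [copiesInvol]

lemma copies_adj_copiesInvol {l k : ℕ} (π : Fin l → Equiv.Perm (Fin k)) (x) :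
    (copies l (balancedK k)).Adj x (copiesInvol π x) := by
  rcases x with ⟨i, a | a⟩ <;> simp [copiesInvol, copies]

lemma copiesInvol_injective {l k : ℕ} :
    Function.Injective (copiesInvol : (Fin l → Equiv.Perm (Fin k)) → _) := by
  intro π ρ h
  ext i a : 2
  simpa [copiesInvol] using congrFun h (i, .inl a)

/-- One permutation per component gives a matching. Only this lower bound is needed, since the upper
one comes from ω. -/
lemma le_perfmat_unionK : k ! ^ l₁ * (k + 1)! ^ l₂ ≤ perfmat (unionK l₁ l₂ k) := by
  rw [perfmat, Nat.card_congr (perfectMatchingEquiv _)]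
  have hinv : ∀ p : (Fin l₁ → Equiv.Perm (Fin k)) × (Fin l₂ → Equiv.Perm (Fin (k + 1))),
      Function.Involutive (Sum.map (copiesInvol p.1) (copiesInvol p.2)) := by
    rintro p (x | x) <;> simp [copiesInvol_involutive _ x]
  let f : (Fin l₁ → Equiv.Perm (Fin k)) × (Fin l₂ → Equiv.Perm (Fin (k + 1))) →
      {σ : Equiv.Perm _ // (∀ v, σ (σ v) = v) ∧ ∀ v, (unionK l₁ l₂ k).Adj v (σ v)} := fun p =>
    ⟨(hinv p).toPerm, hinv p, by
      rintro (x | x)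
      · exact copies_adj_copiesInvol p.1 x
      · exact copies_adj_copiesInvol p.2 x⟩
  have hf : Function.Injective f := by
    intro p q h
    have h' : ∀ x, Sum.map (copiesInvol p.1) (copiesInvol p.2) x =
        Sum.map (copiesInvol q.1) (copiesInvol q.2) x := fun x =>
      congrArg (fun σ => σ.1 x) h
    refine Prod.ext (copiesInvol_injective (funext fun x => ?_))
      (copiesInvol_injective (funext fun x => ?_))
    · exact Sum.inl_injective (h' (.inl x))
    · exact Sum.inr_injective (h' (.inr x))
  calc _ = Nat.card ((Fin l₁ → Equiv.Perm (Fin k)) × (Fin l₂ → Equiv.Perm (Fin (k + 1)))) := by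
        simp [Nat.card_eq_fintype_card, Fintype.card_perm]
    _ ≤ _ := Nat.card_le_card_of_injective f hf

end Labels

/-! ### From equal neighbourhoods to complete bipartite components -/

section Structure

universe u

variable {V : Type u} [Fintype V] {G : SimpleGraph V}

/-- A graph with a perfect matching in which vertices with a common neighbour have the same
neighbours is a disjoint union of complete bipartite graphs: its vertices can be
labelled by components and sides. -/
lemma exists_labels {σ : V → V} (hadj : ∀ v, G.Adj v (σ v))
    (htwin : ∀ u v c d, G.Adj u c → G.Adj v c → G.Adj u d → G.Adj v d) :
    ∃ (I : Type u) (a : V → I) (s : V → Bool), Function.Surjective a ∧ Finite I ∧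
      (∀ v w, G.Adj v w ↔ a v = a w ∧ s v ≠ s w) := by
  classical
  have hN : ∀ u v c, G.Adj u c → G.Adj v c → G.neighborSet u = G.neighborSet v :=
    fun u v c hu hv => Set.ext fun d => ⟨htwin u v c d hu hv, htwin v u c d hv hu⟩
  -- The two sides of the component of v are the neighbourhoods of v and σ v. Their unordered pair
  -- names the component; a chosen representative of the pair tells the sides apart.
  let K : V → Sym2 (Set V) := fun v => s(G.neighborSet v, G.neighborSet (σ v))
  let s : V → Bool := fun v => decide (G.neighborSet v = (K v).out.1)
  have hK : ∀ v, (K v).out.1 = G.neighborSet v ∨ (K v).out.1 = G.neighborSet (σ v) := by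
    intro v
    have := Sym2.out_fst_mem (K v)
    rwa [Sym2.mem_iff] at this
  have main : ∀ v w, G.Adj v w ↔ K v = K w ∧ s v ≠ s w := by
    intro v w
    constructor
    · intro h
      have h1 : G.neighborSet w = G.neighborSet (σ v) := hN _ _ v h.symm (hadj v).symm
      have h2 : G.neighborSet v = G.neighborSet (σ w) := hN _ _ w h (hadj w).symm
      have hKK : K v = K w := by
        change s(_, _) = s(_, _)
        rw [← h1, ← h2, Sym2.eq_swap]
      have hne : G.neighborSet v ≠ G.neighborSet w := fun e =>
        G.irrefl (show w ∈ G.neighborSet w from e ▸ h)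
      refine ⟨hKK, ?_⟩
      change decide _ ≠ decide _
      rw [← hKK]
      rcases hK v with e | e
      · rw [e]; simp [hne.symm]
      · rw [e, ← h1]; simp [hne]
    · rintro ⟨h1, h2⟩
      have hne : G.neighborSet v ≠ G.neighborSet w := by
        intro e
        apply h2
        change decide _ = decide _
        rw [e, h1]
      have h3 := Sym2.eq_iff.1 h1
      have h4 : G.neighborSet v = G.neighborSet (σ w) := by
        rcases h3 with h | h
        · exact absurd h.1 hne
        · exact h.1
      have h5 : w ∈ G.neighborSet (σ w) := (hadj w).symm
      rw [← h4] at h5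
      exact h5
  refine ⟨Set.range K, Set.rangeFactorization K, s, Set.rangeFactorization_surjective,
    inferInstance, fun v w => (main v w).trans (and_congr_left' ?_)⟩
  simp [Set.rangeFactorization, Subtype.ext_iff]

lemma nonempty_iso_unionK [DecidableRel G.Adj] {σ : Equiv.Perm V} (hσ : ∀ v, σ (σ v) = v)
    (hadj : ∀ v, G.Adj v (σ v))
    (htwin : ∀ u v c d, G.Adj u c → G.Adj v c → G.Adj u d → G.Adj v d) {k : ℕ}
    (hk : ∀ v, G.degree v = k ∨ G.degree v = k + 1) :
    ∃ l₁ l₂ : ℕ, Nonempty (G ≃g unionK l₁ l₂ k) := by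
  classical
  obtain ⟨I, a, s, hsurj, hfin, hG⟩ := exists_labels hadj htwin
  -- The matching injects the neighbours of v into those of σ v, so the two sides have equal size.
  have hbal : ∀ v, G.degree (σ v) = G.degree v := by
    have hle : ∀ v, G.degree (σ v) ≤ G.degree v := by
      intro v
      rw [← SimpleGraph.card_neighborFinset_eq_degree, ← SimpleGraph.card_neighborFinset_eq_degree]
      refine card_le_card_of_injOn σ (fun w hw => ?_) σ.injective.injOn
      simp only [SimpleGraph.coe_neighborFinset, SimpleGraph.mem_neighborSet] at hw ⊢
      exact htwin w v (σ v) (σ w) hw.symm (hadj v) (hadj w)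
    intro v
    refine le_antisymm (hle v) ?_
    have := hle (σ v)
    rwa [hσ] at this
  have hpart : ∀ v x, Nat.card {w // (a w, s w) = (a v, x)} = G.degree v := by
    intro v x
    by_cases hx : x = !s v
    · rw [hx, degree_eq_card_part hG]
    · have h := (hG v (σ v)).1 (hadj v)
      have hx' : x = !s (σ v) := by
        have := h.2
        revert hx this
        cases x <;> cases s v <;> cases s (σ v) <;> simp
      rw [← hbal v, degree_eq_card_part hG (σ v), ← h.1, hx']
  let D : I → ℕ := fun i => Nat.card {w // (a w, s w) = (i, true)}
  have hD : ∀ i, D i = k ∨ D i = k + 1 := by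
    intro i
    obtain ⟨v, rfl⟩ := hsurj i
    change Nat.card _ = k ∨ Nat.card _ = k + 1
    rw [hpart]
    exact hk v
  let e : I ≃ Fin (Nat.card {i // D i = k}) ⊕ Fin (Nat.card {i // ¬ D i = k}) :=
    (Equiv.sumCompl fun i => D i = k).symm.trans
      ((Finite.equivFin _).sumCongr (Finite.equivFin _))
  have he' : ∀ j, D (e.symm j) = Sum.elim (fun _ => k) (fun _ => k + 1) j := by
    rintro (j | j)
    · exact ((Finite.equivFin {i // D i = k}).symm j).2
    · exact (hD _).resolve_left ((Finite.equivFin {i // ¬ D i = k}).symm j).2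
  have he : ∀ i, Sum.elim (fun _ => k) (fun _ => k + 1) (e i) = D i := fun i => by
    rw [← he', e.symm_apply_apply]
  refine ⟨_, _, nonempty_iso_of_labels hG unionK_adj_iff e fun i x => ?_⟩
  rw [← Finite.card_eq, card_unionK_part, he]
  obtain ⟨v, rfl⟩ := hsurj i
  exact (hpart v x).trans (hpart v true).symm

end Structure

/-! ### The bound by ω, its extremal graphs and their parameters -/

section Main

variable {V : Type*} [Fintype V] {G : SimpleGraph V} {n m : ℕ}

lemma perfmat_le_omega (hn : 0 < n) (hnm : n ≤ m) (hV : Fintype.card V = 2 * n)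
    (hG : G ∈ graphs V m) :
    (perfmat G : ℝ) ≤ omega n m ∧
    ((perfmat G : ℝ) = omega n m → ∃ l₁ l₂ : ℕ, Nonempty (G ≃g unionK l₁ l₂ (m / n))) := by
  classical
  rw [perfmat_eq_card_matchingsOn]
  -- Without perfect matchings logarithms say nothing, but then 0 < ω settles both claims.
  rcases (matchingsOn G univ).eq_empty_or_nonempty with h0 | hne
  · rw [h0, card_empty, Nat.cast_zero]
    exact ⟨(omega_pos n m).le, fun h => absurd h (omega_pos n m).ne⟩
  have hdeg : ∀ v, 1 ≤ G.degree v := by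
    obtain ⟨σ, hσ⟩ := hne
    intro v
    rw [← degOn_univ]
    exact degOn_pos hσ (mem_univ v)
  have hpos : (0 : ℝ) < #(matchingsOn G univ) := by exact_mod_cast card_pos.2 hne
  have h1 := log_card_le_logBound hne
  obtain ⟨h2, h3⟩ := sum_logFac_le_log_omega hn hnm hdeg hV (sum_degrees_of_mem_graphs G hG)
  have h4 : logBound G univ = ∑ v, logFac (G.degree v) / 2 := by
    simp only [logBound, degOn_univ]
  refine ⟨(Real.log_le_log_iff hpos (omega_pos n m)).1 (by linarith), fun heq => ?_⟩
  rw [← heq] at h2 h3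
  have htwin := adj_of_log_card_eq_logBound hne (by linarith)
  obtain ⟨σ, hσ⟩ := hne
  obtain ⟨s1, s2, -⟩ := mem_matchingsOn.1 hσ
  exact nonempty_iso_unionK s1 (fun v => s2 v (mem_univ v))
    (fun u v c d => htwin u (mem_univ u) v (mem_univ v) c (mem_univ c) d (mem_univ d))
    (h3.1 (by linarith))

lemma mem_graphs_of_iso {V W : Type*} {G : SimpleGraph V} {H : SimpleGraph W}
    (e : G ≃g H) (hH : H ∈ graphs W m) :
    G ∈ graphs V m := by
  change G.edgeSet.ncard = m
  rw [← show H.edgeSet.ncard = m from hH, ← Nat.card_coe_set_eq, ← Nat.card_coe_set_eq]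
  exact Nat.card_congr e.mapEdgeSet

lemma eq_of_iso_unionK {l₁ l₂ k : ℕ} (hV : Fintype.card V = 2 * n) (hG : G ∈ graphs V m)
    (e : G ≃g unionK l₁ l₂ k) :
    n = l₁ * k + l₂ * (k + 1) ∧ m = l₁ * k ^ 2 + l₂ * (k + 1) ^ 2 := by
  constructor
  · have := Fintype.card_congr e.toEquiv
    rw [card_unionK] at this
    omega
  · rw [← ncard_edgeSet_unionK, ← show G.edgeSet.ncard = m from hG, ← Nat.card_coe_set_eq,
      ← Nat.card_coe_set_eq]
    exact Nat.card_congr e.mapEdgeSet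

lemma div_eq_of_eq {l₁ l₂ k : ℕ} (h₁ : 1 ≤ l₁) (hk : 1 ≤ k) (hn : n = l₁ * k + l₂ * (k + 1))
    (hm : m = l₁ * k ^ 2 + l₂ * (k + 1) ^ 2) : m / n = k := by
  have hlk : 1 ≤ l₁ * k := Nat.mul_pos h₁ hk
  apply Nat.div_eq_of_lt_le
  · subst hn hm; nlinarith
  · subst hn hm; nlinarith

lemma omega_eq {l₁ l₂ k : ℕ} (h₁ : 1 ≤ l₁) (hk : 1 ≤ k) (hn : n = l₁ * k + l₂ * (k + 1))
    (hm : m = l₁ * k ^ 2 + l₂ * (k + 1) ^ 2) :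
    omega n m = ((k ! ^ l₁ * (k + 1)! ^ l₂ : ℕ) : ℝ) := by
  have hlk : 1 ≤ l₁ * k := Nat.mul_pos h₁ hk
  have hpos : (0 : ℝ) < ((k ! ^ l₁ * (k + 1)! ^ l₂ : ℕ) : ℝ) := by positivity
  refine Real.log_injOn_pos (omega_pos n m) hpos ?_
  rw [log_omega (by omega), div_eq_of_eq h₁ hk hn hm]
  push_cast
  rw [Real.log_mul (by positivity) (by positivity), Real.log_pow, Real.log_pow, ← mul_logFac,
    ← mul_logFac, hn, hm]
  push_cast
  ring

lemma perfmat_eq_omega_of_iso {l₁ l₂ k : ℕ} (h₁ : 1 ≤ l₁) (hk : 1 ≤ k)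
    (hV : Fintype.card V = 2 * n) (hG : G ∈ graphs V m) (e : G ≃g unionK l₁ l₂ k) :
    (perfmat G : ℝ) = omega n m := by
  obtain ⟨hn, hm⟩ := eq_of_iso_unionK hV hG e
  have hlk : 1 ≤ l₁ * k := Nat.mul_pos h₁ hk
  refine le_antisymm (perfmat_le_omega (by omega) ?_ hV hG).1 ?_
  · subst hn hm; nlinarith
  · rw [omega_eq h₁ hk hn hm, perfmat_congr e]
    exact_mod_cast le_perfmat_unionK

/-- If l₁ = 0 then m = (k + 1) n, and the quotient would be k + 1. -/
lemma one_le_of_div_eq {l₁ l₂ k : ℕ} (h0 : 0 < n) (hq : m / n = k)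
    (hn : n = l₁ * k + l₂ * (k + 1)) (hm : m = l₁ * k ^ 2 + l₂ * (k + 1) ^ 2) : 1 ≤ l₁ := by
  by_contra h
  obtain rfl : l₁ = 0 := by omega
  have := Nat.lt_mul_div_succ m h0
  rw [hq] at this
  subst hn hm
  nlinarith

/-- Both parameters can be read off, because m − k n = l₂ (k + 1). -/
lemma unionK_params_unique {l₁ l₂ l₁' l₂' k : ℕ} (hk : 1 ≤ k)
    (hn : l₁ * k + l₂ * (k + 1) = l₁' * k + l₂' * (k + 1))
    (hm : l₁ * k ^ 2 + l₂ * (k + 1) ^ 2 = l₁' * k ^ 2 + l₂' * (k + 1) ^ 2) :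
    l₁ = l₁' ∧ l₂ = l₂' := by
  have h2 : l₂ * (k + 1) = l₂' * (k + 1) := by
    zify at hn hm ⊢
    linear_combination hm - k * hn
  have h1 : l₁ * k = l₁' * k := by omega
  exact ⟨Nat.eq_of_mul_eq_mul_right hk h1, Nat.eq_of_mul_eq_mul_right (by omega) h2⟩

lemma graphs_nonempty (hm : m ≤ (2 * n).choose 2) : (graphs (Fin (2 * n)) m).Nonempty := by
  classical
  have hcard : m ≤ #((⊤ : SimpleGraph (Fin (2 * n))).edgeFinset) := by
    rwa [SimpleGraph.card_edgeFinset_top_eq_card_choose_two, Fintype.card_fin]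
  obtain ⟨E, hE, hEm⟩ := exists_subset_card_eq hcard
  refine ⟨SimpleGraph.fromEdgeSet E, ?_⟩
  change (SimpleGraph.fromEdgeSet (E : Set (Sym2 (Fin (2 * n))))).edgeSet.ncard = m
  rw [SimpleGraph.edgeSet_fromEdgeSet, ← hEm, ← Set.ncard_coe_finset]
  congr 1
  rw [sdiff_eq_left, Set.disjoint_left]
  intro x hx hd
  have := hE hx
  rw [SimpleGraph.mem_edgeFinset] at this
  exact SimpleGraph.not_isDiag_of_mem_edgeSet _ this hd

lemma isGreatest_mu (hm : m ≤ (2 * n).choose 2) :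
    IsGreatest (perfmat '' graphs (Fin (2 * n)) m) (mu n m) := by
  have hfin : (perfmat '' graphs (Fin (2 * n)) m).Finite := (Set.toFinite _).image _
  exact ⟨Nat.sSup_mem ((graphs_nonempty hm).image _) hfin.bddAbove,
    fun x hx => le_csSup hfin.bddAbove hx⟩

end Main

end PerfMatBound

theorem mainTheorem1 (n m : ℕ) (hn : 0 < n) (hnm : n ≤ m) (hm : m ≤ (2 * n).choose 2) :
    -- the degree product bound with its equality case, and the bound on perfect matchings
    (∀ (V : Type*) [Fintype V] (G : SimpleGraph V) [DecidableRel G.Adj],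
      Fintype.card V = 2 * n → G ∈ PerfMatBound.graphs V m →
        PerfMatBound.degProd G ≤ PerfMatBound.omega n m ∧
        (PerfMatBound.degProd G = PerfMatBound.omega n m ↔ PerfMatBound.AlmostRegular G) ∧
        (PerfMatBound.perfmat G : ℝ) ≤ PerfMatBound.omega n m) ∧
    -- the maximum `μ(2n, m)` is attained and is at most `ω(2n, m)`
    IsGreatest (PerfMatBound.perfmat '' PerfMatBound.graphs (Fin (2 * n)) m)
      (PerfMatBound.mu n m) ∧
    (PerfMatBound.mu n m : ℝ) ≤ PerfMatBound.omega n m ∧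
    -- equality holds iff there is a graph of the form `l₁ K_{k,k} ∪ l₂ K_{k+1,k+1}`
    ((PerfMatBound.mu n m : ℝ) = PerfMatBound.omega n m ↔
      ∃ G ∈ PerfMatBound.graphs (Fin (2 * n)) m, ∃ l₁ l₂ k : ℕ, 1 ≤ l₁ ∧ 1 ≤ k ∧
        Nonempty (G ≃g PerfMatBound.unionK l₁ l₂ k)) ∧
    -- that is, iff `n` and `m` have the corresponding form
    ((PerfMatBound.mu n m : ℝ) = PerfMatBound.omega n m ↔
      ∃ l₁ l₂ k : ℕ, 1 ≤ l₁ ∧ 1 ≤ k ∧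
        n = l₁ * k + l₂ * (k + 1) ∧ m = l₁ * k ^ 2 + l₂ * (k + 1) ^ 2) ∧
    -- in that case this graph is, up to isomorphism, the unique maximizer
    (∀ l₁ l₂ k : ℕ, 1 ≤ l₁ → 1 ≤ k →
      n = l₁ * k + l₂ * (k + 1) → m = l₁ * k ^ 2 + l₂ * (k + 1) ^ 2 →
      ∀ (V : Type*) [Fintype V] (G : SimpleGraph V),
        Fintype.card V = 2 * n → G ∈ PerfMatBound.graphs V m →
          (PerfMatBound.perfmat G = PerfMatBound.mu n m ↔
            Nonempty (G ≃g PerfMatBound.unionK l₁ l₂ k))) := by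
  obtain hmu := PerfMatBound.isGreatest_mu hm
  have hle : (PerfMatBound.mu n m : ℝ) ≤ PerfMatBound.omega n m := by
    obtain ⟨G, hG, h⟩ := hmu.1
    rw [← h]
    exact (PerfMatBound.perfmat_le_omega hn hnm (Fintype.card_fin _) hG).1
  have hq : 1 ≤ m / n := (Nat.one_le_div_iff hn).2 hnm
  have exG : (PerfMatBound.mu n m : ℝ) = PerfMatBound.omega n m →
      ∃ G ∈ PerfMatBound.graphs (Fin (2 * n)) m, ∃ l₁ l₂ k : ℕ, 1 ≤ l₁ ∧ 1 ≤ k ∧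
        Nonempty (G ≃g PerfMatBound.unionK l₁ l₂ k) := by
    intro h
    obtain ⟨G, hG, hG'⟩ := hmu.1
    rw [← hG'] at h
    obtain ⟨l₁, l₂, ⟨e⟩⟩ := (PerfMatBound.perfmat_le_omega hn hnm (Fintype.card_fin _) hG).2 h
    obtain ⟨h1, h2⟩ := PerfMatBound.eq_of_iso_unionK (Fintype.card_fin _) hG e
    exact ⟨G, hG, l₁, l₂, m / n, PerfMatBound.one_le_of_div_eq hn rfl h1 h2, hq, ⟨e⟩⟩
  have exN : (∃ G ∈ PerfMatBound.graphs (Fin (2 * n)) m, ∃ l₁ l₂ k : ℕ, 1 ≤ l₁ ∧ 1 ≤ k ∧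
        Nonempty (G ≃g PerfMatBound.unionK l₁ l₂ k)) →
      ∃ l₁ l₂ k : ℕ, 1 ≤ l₁ ∧ 1 ≤ k ∧
        n = l₁ * k + l₂ * (k + 1) ∧ m = l₁ * k ^ 2 + l₂ * (k + 1) ^ 2 := by
    rintro ⟨G, hG, l₁, l₂, k, h1, hk, ⟨e⟩⟩
    exact ⟨l₁, l₂, k, h1, hk, PerfMatBound.eq_of_iso_unionK (Fintype.card_fin _) hG e⟩
  have toEq : (∃ l₁ l₂ k : ℕ, 1 ≤ l₁ ∧ 1 ≤ k ∧
        n = l₁ * k + l₂ * (k + 1) ∧ m = l₁ * k ^ 2 + l₂ * (k + 1) ^ 2) →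
      (PerfMatBound.mu n m : ℝ) = PerfMatBound.omega n m := by
    rintro ⟨l₁, l₂, k, h1, hk, hn', hm'⟩
    refine le_antisymm hle ?_
    -- The maximum is taken over graphs on `Fin (2 * n)`, so the union is transported there.
    let f : Fin (2 * n) ≃ _ := Fintype.equivOfCardEq
      ((Fintype.card_fin (2 * n)).trans
        ((congrArg (2 * ·) hn').trans
          (PerfMatBound.card_unionK (l₁ := l₁) (l₂ := l₂) (k := k)).symm))
    let e := SimpleGraph.Iso.comap f (PerfMatBound.unionK l₁ l₂ k)
    have hG : (PerfMatBound.unionK l₁ l₂ k).comap f ∈ PerfMatBound.graphs (Fin (2 * n)) m :=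
      PerfMatBound.mem_graphs_of_iso e (PerfMatBound.ncard_edgeSet_unionK.trans hm'.symm)
    rw [← PerfMatBound.perfmat_eq_omega_of_iso h1 hk (Fintype.card_fin _) hG e]
    exact_mod_cast hmu.2 (Set.mem_image_of_mem _ hG)
  refine ⟨fun V _ G _ hV hG => ?_, hmu, hle, ⟨exG, fun h => toEq (exN h)⟩,
    ⟨fun h => exN (exG h), toEq⟩, fun l₁ l₂ k h1 hk hn' hm' V _ G hV hG => ?_⟩
  · obtain ⟨h1, h2⟩ := PerfMatBound.degProd_le_omega G hn hnm hV hG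
    exact ⟨h1, h2, (PerfMatBound.perfmat_le_omega hn hnm hV hG).1⟩
  · have heq := toEq ⟨l₁, l₂, k, h1, hk, hn', hm'⟩
    constructor
    · intro h
      rw [← h] at heq
      obtain ⟨l₁', l₂', he⟩ := (PerfMatBound.perfmat_le_omega hn hnm hV hG).2 heq
      rw [PerfMatBound.div_eq_of_eq h1 hk hn' hm'] at he
      obtain ⟨e⟩ := he
      obtain ⟨hn2, hm2⟩ := PerfMatBound.eq_of_iso_unionK hV hG e
      obtain ⟨rfl, rfl⟩ :=
        PerfMatBound.unionK_params_unique hk (hn'.symm.trans hn2) (hm'.symm.trans hm2)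
      exact ⟨e⟩
    · rintro ⟨e⟩
      have := PerfMatBound.perfmat_eq_omega_of_iso h1 hk hV hG e
      rw [← heq] at this
      exact_mod_cast this
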